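/- Let $q>0$, and consider on $\mathbb{R}^3$ the repulsive Kepler system $$\dot{x}=v,\qquad \dot v=\frac q2\frac{x}{|x|^3}, \tag{ODE}$$ with energy $H(x,v)=|v|^2+\frac{q}{|x|}$. Put $\mathcal{P}_{x,v}=\{(x,v)\in\mathbb{R}^3\times\mathbb{R}^3:|x|>0\}$ and $\mathcal{P}_{\vartheta,a}=\{(\vartheta,a)\in\mathbb{R}^3\times\mathbb{R}^3:|a|>0\}$. For $x,a\neq 0$ and $s\ge 1$ put $$\rho(x,a)=\frac{|a|}{2q}\left(x\cdot a+|x||a|\right),\qquad K(s)=\sqrt{s(s-1)}-\ln\left(\sqrt s+\sqrt{s-1}\right),$$ and, where $\rho(x,a)\ge 1$, $$S_\pm(x,a)=\pm\frac{q}{|a|}K(\rho(x,a))-\frac{|x||a|-x\cdot a}{2}.$$ There exists a smooth ($C^\infty$) diffeomorphism $T:\mathcal{P}_{x,v}\to\mathcal{P}_{\vartheta,a}$, $(x,v)\mapsto(\Theta(x,v),\mathcal{A}(x,v))$, with smooth inverse $(\vartheta,a)\mapsto(X(\vartheta,a),V(\vartheta,a))$, such that: 1. $T$ is canonical, i.e.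 $\sum_j dx_j\wedge dv_j=\sum_j d\Theta_j\wedge d\mathcal{A}_j$ on $\mathcal{P}_{x,v}$. 2. For all $(x,v)\in\mathcal{P}_{x,v}$: $H(x,v)=|\mathcal{A}(x,v)|^2$ and $x\times v=\Theta(x,v)\times\mathcal{A}(x,v)$. 3. $T$ linearizes the flow: for every interval $I\subseteq\mathbb{R}$ with $0\in I$, a curve $(x(t),v(t))_{t\in I}$ in $\mathcal{P}_{x,v}$ solves (ODE) on $I$ if and only if, for all $t\in I$, $$\Theta(x(t),v(t))=\Theta(x(0),v(0))+t\,\mathcal{A}(x(0),v(0)),\qquad \mathcal{A}(x(t),v(t))=\mathcal{A}(x(0),v(0)).$$ 4. $T$ has the asymptotic action property: for every $(\vartheta,a)\in\mathcal{P}_{\vartheta,a}$, as $t\to+\infty$, $$|X(\vartheta+ta,a)-ta|=o(t),\qquad |V(\vartheta+ta,a)-a|=o(1).$$ 5. $T$ is obtained by gluing the maps generated by $S_-$ and $S_+$ across the fold $\Gamma=\{x\cdot v=-\sqrt{H}\,|x\times v|^2/q\}$: for $(x,v)\in\mathcal{P}_{x,v}$ and $a=\mathcal{A}(x,v)$ one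 has $\rho(x,a)\ge 1$, with equality if and only if $(x,v)\in\Gamma$; moreover $$v=\nabla_xS_\iota(x,a),\qquad \Theta(x,v)=\nabla_aS_\iota(x,a),$$ where $\iota=-$ if $x\cdot v<-\sqrt{H}\,|x\times v|^2/q$, and $\iota=+$ if $x\cdot v>-\sqrt{H}\,|x\times v|^2/q$. -/

import Mathlib

open Set Filter Topology Asymptotics
open scoped ContDiff

noncomputable section

namespace Kepler

/-- Three-dimensional Euclidean space. -/
abbrev E3 : Type := EuclideanSpace ℝ (Fin 3)

/-- The cross product of two vectors of Euclidean three-space. -/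
def cross (x y : E3) : E3 := WithLp.toLp 2 (crossProduct x.ofLp y.ofLp)

/-- The phase space of positions and velocities `(x, v)` with `|x| > 0`. -/
def physicalPhaseSpace : Set (E3 × E3) := {z | 0 < ‖z.1‖}

/-- The phase space of angles and actions `(ϑ, a)` with `|a| > 0`. -/
def actionAnglePhaseSpace : Set (E3 × E3) := {w | 0 < ‖w.2‖}

/-- The energy `H(x, v) = |v|² + q / |x|`. -/
def energy (q : ℝ) (x v : E3) : ℝ := ‖v‖ ^ 2 + q / ‖x‖

/-- The curve `(x(t), v(t))` solves `ẋ = v`, `v̇ = (q/2) x / |x|³` on the set of times `I`. -/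
def SolvesKeplerOn (q : ℝ) (I : Set ℝ) (x v : ℝ → E3) : Prop :=
  ∀ t ∈ I, HasDerivWithinAt x (v t) I t ∧
    HasDerivWithinAt v ((q / 2 / ‖x t‖ ^ 3) • x t) I t

/-- The canonical two-form `∑ⱼ dpⱼ ∧ drⱼ` in the coordinates `(p, r)` of `ℝ³ × ℝ³`. -/
def canonicalForm (ξ ζ : E3 × E3) : ℝ :=
  ∑ j : Fin 3, (ξ.1 j * ζ.2 j - ξ.2 j * ζ.1 j)

/-- The map `T` pulls the canonical two-form back to itself at every point of `U`. -/
def IsCanonicalOn (T : E3 × E3 → E3 × E3) (U : Set (E3 × E3)) : Prop :=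
  ∀ z ∈ U, ∀ ξ ζ : E3 × E3,
    canonicalForm (fderiv ℝ T z ξ) (fderiv ℝ T z ζ) = canonicalForm ξ ζ

/-- `K(s) = √(s(s-1)) - ln(√s + √(s-1))`, used for `s ≥ 1`. -/
def K (s : ℝ) : ℝ := √(s * (s - 1)) - Real.log (√s + √(s - 1))

/-- `ρ(x, a) = (|a| / 2q) (x·a + |x||a|)`. -/
def rho (q : ℝ) (x a : E3) : ℝ := ‖a‖ / (2 * q) * (inner ℝ x a + ‖x‖ * ‖a‖)

/-- The generating functions `S_ι(x, a) = ι (q / |a|) K(ρ(x, a)) - (|x||a| - x·a) / 2`,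
with `ι = 1` for `S_+` and `ι = -1` for `S_-`. -/
def generating (q ι : ℝ) (x a : E3) : ℝ :=
  ι * (q / ‖a‖) * K (rho q x a) - (‖x‖ * ‖a‖ - inner ℝ x a) / 2

/-- The function `x·v + √H L² / q`, with `L = |x × v|`: it vanishes exactly on the fold, is negative
before the fold and positive after it. -/
def foldFunction (q : ℝ) (x v : E3) : ℝ :=
  inner ℝ x v + √(energy q x v) * ‖cross x v‖ ^ 2 / q

/-- At `(x, v)`, the map `T = (Θ, 𝒜)` is generated by `S_ι`:
`v = ∇ₓ S_ι(x, a)` and `Θ(x, v) = ∇ₐ S_ι(x, a)` for `a = 𝒜(x, v)`. -/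
def GeneratedAt (q ι : ℝ) (T : E3 × E3 → E3 × E3) (x v : E3) : Prop :=
  HasGradientAt (fun y => generating q ι y (T (x, v)).2) v x ∧
    HasGradientAt (fun b => generating q ι x b) (T (x, v)).1 (T (x, v)).2

end Kepler

end

noncomputable section

namespace Kepler

open scoped RealInnerProductSpace

/-! ### The cross product -/

/-! The generating functions `S_±` are two branches of one function. Write α = √H. The equation (w +
1)² = 4wρ has the roots w and 1/w, and `orbitParam` selects one of them smoothly in (x, v): w < 1
before the fold, w = 1 on it, w > 1 after it. Since √(ρ - 1) = |w - 1| / (2√w), the signed value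
±K(ρ) becomes (w - 1/w)/4 - (log w)/2 on both sides (`mul_K_eq`), with no singularity at w = 1.
Solving v = ∇ₓS for a and reading off ∇ₐS then gives the closed formulas `action` and `angle`, which
are smooth on all of phase space.

Bijectivity reduces to one scalar equation. The pair (Θ, 𝒜) determines α = |𝒜| and x × v = Θ × 𝒜,
and Θ·𝒜 is an increasing function `timeFun` of w mapping (0, ∞) onto ℝ; once w is known, |x|, x and
v follow algebraically.

The value of S at a = 𝒜 is x·v - (q / 2α) log w, and its differential is v·dx + Θ·d𝒜
(`fderiv_generatingValue`). Symmetry of second derivatives makes T canonical; nondegeneracy of the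
two-form then makes DT invertible, so the inverse is smooth. The Kepler field is the Hamiltonian
field of H/2 = |𝒜|²/2, hence DT carries it to (𝒜, 0), which linearizes the flow.

Along ϑ + ta, the equation for w forces w → ∞ with w = O(t), while |v - a| = O(1/w) and |x - ta| =
O(1 + log w). -/

lemma inner_eq_sum (x y : E3) : ⟪x, y⟫ = x 0 * y 0 + x 1 * y 1 + x 2 * y 2 := by
  simp [PiLp.inner_apply, Fin.sum_univ_three, mul_comm]

lemma norm_sq_eq_sum (x : E3) : ‖x‖ ^ 2 = x 0 ^ 2 + x 1 ^ 2 + x 2 ^ 2 := by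
  simp [EuclideanSpace.norm_sq_eq, Fin.sum_univ_three]

lemma cross_apply_zero (x y : E3) : cross x y 0 = x 1 * y 2 - x 2 * y 1 := by
  simp [cross, crossProduct]

lemma cross_apply_one (x y : E3) : cross x y 1 = x 2 * y 0 - x 0 * y 2 := by
  simp [cross, crossProduct]

lemma cross_apply_two (x y : E3) : cross x y 2 = x 0 * y 1 - x 1 * y 0 := by
  simp [cross, crossProduct]

lemma norm_cross_sq (x y : E3) : ‖cross x y‖ ^ 2 = ‖x‖ ^ 2 * ‖y‖ ^ 2 - ⟪x, y⟫ ^ 2 := by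
  simp only [norm_sq_eq_sum, inner_eq_sum, cross_apply_zero, cross_apply_one, cross_apply_two]
  ring

lemma cross_add_smul_self (x y : E3) (c d : ℝ) :
    cross (c • x + d • y) y = c • cross x y := by
  ext j
  fin_cases j <;>
    simp [cross_apply_zero, cross_apply_one, cross_apply_two] <;> ring

lemma cross_smul_add_smul_self (x y : E3) (c d : ℝ) :
    cross x (c • y + d • x) = c • cross x y := by
  ext j
  fin_cases j <;>
    simp [cross_apply_zero, cross_apply_one, cross_apply_two] <;> ring

/-! ### The action-angle map -/

/-- The asymptotic speed `√H` of the orbit through `z = (x, v)`. -/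
def speed (q : ℝ) (z : E3 × E3) : ℝ := √(energy q z.1 z.2)

/-- The parameter `w = (2√H / q) (x·v + √H |x|) - 1` along the orbit: it is positive, it equals `1`
exactly on the fold, and `(w + 1)² = 4 w ρ`. -/
def orbitParam (q : ℝ) (z : E3 × E3) : ℝ :=
  2 * speed q z / q * (⟪z.1, z.2⟫ + speed q z * ‖z.1‖) - 1

/-- The action, that is, the asymptotic velocity of the orbit through `z = (x, v)`. -/
def action (q : ℝ) (z : E3 × E3) : E3 :=
  (orbitParam q z)⁻¹ • ((orbitParam q z + 1) • z.2 + (speed q z / ‖z.1‖) • z.1)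

/-- The component of the angle along the action, once the component along `x` is removed. -/
def drift (q : ℝ) (z : E3 × E3) : ℝ :=
  q * Real.log (orbitParam q z) / (2 * speed q z ^ 3)
    - ‖z.1‖ / (speed q z * (orbitParam q z + 1))

/-- The angle of `z = (x, v)`. -/
def angle (q : ℝ) (z : E3 × E3) : E3 :=
  (orbitParam q z / (orbitParam q z + 1)) • z.1 + drift q z • action q z

/-- The map `(x, v) ↦ (Θ, 𝒜)`. -/
def actionAngle (q : ℝ) (z : E3 × E3) : E3 × E3 := (angle q z, action q z)

variable {q : ℝ} {z : E3 × E3}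

lemma energy_pos (hq : 0 < q) (hz : 0 < ‖z.1‖) : 0 < energy q z.1 z.2 := by
  unfold energy; positivity

lemma speed_pos (hq : 0 < q) (hz : 0 < ‖z.1‖) : 0 < speed q z :=
  Real.sqrt_pos.2 (energy_pos hq hz)

lemma speed_sq (hq : 0 < q) (hz : 0 < ‖z.1‖) : speed q z ^ 2 = ‖z.2‖ ^ 2 + q / ‖z.1‖ :=
  Real.sq_sqrt (energy_pos hq hz).le

lemma speed_sq_mul (hq : 0 < q) (hz : 0 < ‖z.1‖) :
    speed q z ^ 2 * ‖z.1‖ = ‖z.2‖ ^ 2 * ‖z.1‖ + q := by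
  rw [speed_sq hq hz]; field_simp

lemma mul_orbitParam_add_one (hq : 0 < q) :
    q * (orbitParam q z + 1) = 2 * speed q z * (⟪z.1, z.2⟫ + speed q z * ‖z.1‖) := by
  unfold orbitParam; field_simp; ring

/-- Substituting q = (α² - |v|²)|x| and the Cauchy–Schwarz bound x·v ≥ -|x||v| gives qw ≥ |x|(α -
|v|)², and α ≠ |v| because q > 0. -/
lemma orbitParam_pos (hq : 0 < q) (hz : 0 < ‖z.1‖) : 0 < orbitParam q z := by
  have h1 := mul_orbitParam_add_one (z := z) hq
  have h2 := speed_sq_mul hq hz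
  have hα := speed_pos hq hz
  have h3 : -(‖z.1‖ * ‖z.2‖) ≤ ⟪z.1, z.2⟫ := neg_le_of_abs_le (abs_real_inner_le_norm _ _)
  have h4 : speed q z - ‖z.2‖ ≠ 0 := by
    intro h
    have : speed q z = ‖z.2‖ := by linarith
    rw [this] at h2
    linarith
  have h5 : 0 < ‖z.1‖ * (speed q z - ‖z.2‖) ^ 2 := by positivity
  have h6 := mul_le_mul_of_nonneg_left h3 hα.le
  have : 0 < q * orbitParam q z := by nlinarith
  exact pos_of_mul_pos_right this hq.le

/-- `x·v` in terms of the speed, the distance and the orbit parameter. -/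
lemma inner_eq (hq : 0 < q) (hz : 0 < ‖z.1‖) :
    ⟪z.1, z.2⟫ = q * (orbitParam q z + 1) / (2 * speed q z) - speed q z * ‖z.1‖ := by
  have hα := speed_pos hq hz
  rw [mul_orbitParam_add_one hq]; field_simp; ring

/-- With x·v and |v| eliminated, α, |x| and w serve as scalar coordinates; later identities become
rational identities in them, up to a logarithm. -/
lemma norm_cross_sq_eq (hq : 0 < q) (hz : 0 < ‖z.1‖) :
    ‖cross z.1 z.2‖ ^ 2 =
      q * orbitParam q z * ‖z.1‖ - q ^ 2 * (orbitParam q z + 1) ^ 2 / (4 * speed q z ^ 2) := by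
  have hα := speed_pos hq hz
  have h : ‖z.1‖ ^ 2 * ‖z.2‖ ^ 2 = speed q z ^ 2 * ‖z.1‖ ^ 2 - q * ‖z.1‖ := by
    linear_combination (-‖z.1‖) * speed_sq_mul hq hz
  rw [norm_cross_sq, h, inner_eq hq hz]; field_simp; ring

lemma orbitParam_smul_action (hq : 0 < q) (hz : 0 < ‖z.1‖) :
    orbitParam q z • action q z =
      (orbitParam q z + 1) • z.2 + (speed q z / ‖z.1‖) • z.1 :=
  smul_inv_smul₀ (orbitParam_pos hq hz).ne' _

lemma inner_fst_action (hq : 0 < q) (hz : 0 < ‖z.1‖) :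
    ⟪z.1, action q z⟫ =
      q * (orbitParam q z + 1) ^ 2 / (2 * speed q z * orbitParam q z) - speed q z * ‖z.1‖ := by
  have hα := speed_pos hq hz
  have hw := orbitParam_pos hq hz
  simp only [action, inner_smul_right, inner_add_right, inner_eq hq hz,
    real_inner_self_eq_norm_sq]
  field_simp; ring

lemma norm_action_sq (hq : 0 < q) (hz : 0 < ‖z.1‖) : ‖action q z‖ ^ 2 = speed q z ^ 2 := by
  have hα := speed_pos hq hz
  have hw := orbitParam_pos hq hz
  have h : ‖z.2‖ ^ 2 = speed q z ^ 2 - q / ‖z.1‖ := by rw [speed_sq hq hz]; ring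
  rw [← real_inner_self_eq_norm_sq]
  simp only [action, inner_smul_right, inner_smul_left, inner_add_right, inner_add_left,
    real_inner_comm z.1 z.2, inner_eq hq hz, real_inner_self_eq_norm_sq, h]
  simp only [RCLike.conj_to_real]
  field_simp; ring

lemma norm_action (hq : 0 < q) (hz : 0 < ‖z.1‖) : ‖action q z‖ = speed q z :=
  (sq_eq_sq₀ (norm_nonneg _) (speed_pos hq hz).le).1 (norm_action_sq hq hz)

/-- The factor w/(w + 1) on x in Θ cancels the factor (w + 1)/w on v in 𝒜; the remaining terms are
parallel. -/
lemma cross_angle_action (hq : 0 < q) (hz : 0 < ‖z.1‖) :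
    cross (angle q z) (action q z) = cross z.1 z.2 := by
  have hw := orbitParam_pos hq hz
  rw [angle, cross_add_smul_self, action, smul_add, smul_smul, smul_smul,
    cross_smul_add_smul_self, smul_smul]
  convert one_smul ℝ _
  field_simp

/-- The increasing function of the orbit parameter `w` that gives the time along an orbit with
asymptotic speed `α` and squared angular momentum `l`. -/
def timeFun (q α l w : ℝ) : ℝ :=
  q / (4 * α) * (w - w⁻¹) + q / (2 * α) * Real.log w - α * l / q * w⁻¹

lemma inner_angle_action (hq : 0 < q) (hz : 0 < ‖z.1‖) :
    ⟪angle q z, action q z⟫ =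
      timeFun q (speed q z) (‖cross z.1 z.2‖ ^ 2) (orbitParam q z) := by
  have hα := speed_pos hq hz
  have hw := orbitParam_pos hq hz
  rw [angle, inner_add_left, inner_smul_left, inner_smul_left, inner_fst_action hq hz,
    real_inner_self_eq_norm_sq, norm_action_sq hq hz, norm_cross_sq_eq hq hz, drift, timeFun]
  simp only [RCLike.conj_to_real]
  field_simp; ring

lemma timeFun_strictMonoOn (hq : 0 < q) {α l : ℝ} (hα : 0 < α) (hl : 0 ≤ l) :
    StrictMonoOn (timeFun q α l) (Ioi 0) := by
  intro w hw w' hw' h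
  rw [mem_Ioi] at hw hw'
  have h1 : w'⁻¹ < w⁻¹ := by gcongr
  have h2 : Real.log w < Real.log w' := Real.log_lt_log hw h
  unfold timeFun
  have h3 : q / (4 * α) * (w - w⁻¹) < q / (4 * α) * (w' - w'⁻¹) := by gcongr
  have h4 : q / (2 * α) * Real.log w < q / (2 * α) * Real.log w' := by gcongr
  have h5 : α * l / q * w'⁻¹ ≤ α * l / q * w⁻¹ := by gcongr
  linarith

lemma exists_timeFun_eq (hq : 0 < q) {α l : ℝ} (hα : 0 < α) (hl : 0 ≤ l) (τ : ℝ) :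
    ∃ w, 0 < w ∧ timeFun q α l w = τ := by
  have hcont : ContinuousOn (timeFun q α l) (Ioi 0) := by
    unfold timeFun
    have h0 : ∀ w ∈ Ioi (0 : ℝ), w ≠ 0 := fun w hw => (mem_Ioi.1 hw).ne'
    fun_prop (disch := assumption)
  have hc : 0 < q / (2 * α) := by positivity
  -- The witness makes the logarithmic term exactly -|τ|; as w ≤ 1, the other two terms are
  -- nonpositive.
  obtain ⟨w₁, h₁, h₁'⟩ : ∃ w ∈ Ioi (0 : ℝ), timeFun q α l w ≤ τ := by
    refine ⟨Real.exp (-|τ| / (q / (2 * α))), Real.exp_pos _, ?_⟩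
    have hle : Real.exp (-|τ| / (q / (2 * α))) ≤ 1 := by
      rw [Real.exp_le_one_iff]
      exact div_nonpos_of_nonpos_of_nonneg (neg_nonpos.2 (abs_nonneg _)) hc.le
    have hinv := (one_le_inv₀ (Real.exp_pos _)).2 hle
    rw [timeFun, Real.log_exp, mul_div_cancel₀ _ hc.ne']
    have h3 : q / (4 * α) * (Real.exp (-|τ| / (q / (2 * α)))
        - (Real.exp (-|τ| / (q / (2 * α))))⁻¹) ≤ 0 :=
      mul_nonpos_of_nonneg_of_nonpos (by positivity) (by linarith)
    have h5 : 0 ≤ α * l / q * (Real.exp (-|τ| / (q / (2 * α))))⁻¹ := by positivity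
    linarith [neg_abs_le τ]
  -- The logarithmic term is now |τ| + αl/q; the extra αl/q absorbs the last term, which is at least
  -- -αl/q for w ≥ 1.
  obtain ⟨w₂, h₂, h₂'⟩ : ∃ w ∈ Ioi (0 : ℝ), τ ≤ timeFun q α l w := by
    refine ⟨Real.exp ((|τ| + α * l / q) / (q / (2 * α))), Real.exp_pos _, ?_⟩
    have hle : 1 ≤ Real.exp ((|τ| + α * l / q) / (q / (2 * α))) := by
      rw [Real.one_le_exp_iff]
      positivity
    have hinv := inv_le_one_of_one_le₀ hle
    rw [timeFun, Real.log_exp, mul_div_cancel₀ _ hc.ne']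
    have h3 : 0 ≤ q / (4 * α) * (Real.exp ((|τ| + α * l / q) / (q / (2 * α)))
        - (Real.exp ((|τ| + α * l / q) / (q / (2 * α))))⁻¹) :=
      mul_nonneg (by positivity) (by linarith)
    have h5 : α * l / q * (Real.exp ((|τ| + α * l / q) / (q / (2 * α))))⁻¹ ≤ α * l / q * 1 := by
      gcongr
    linarith [le_abs_self τ]
  obtain ⟨w, hw, hw'⟩ := isPreconnected_Ioi.intermediate_value h₁ h₂ hcont ⟨h₁', h₂'⟩
  exact ⟨w, hw, hw'⟩

/-- `|x|` in terms of the orbit parameter and the conserved quantities. -/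
lemma norm_fst_eq (hq : 0 < q) (hz : 0 < ‖z.1‖) :
    ‖z.1‖ = (‖cross z.1 z.2‖ ^ 2 + q ^ 2 * (orbitParam q z + 1) ^ 2 / (4 * speed q z ^ 2)) /
      (q * orbitParam q z) := by
  have hw := orbitParam_pos hq hz
  rw [norm_cross_sq_eq hq hz]; field_simp; ring

lemma fst_eq (hq : 0 < q) (hz : 0 < ‖z.1‖) :
    z.1 = ((orbitParam q z + 1) / orbitParam q z) • (angle q z - drift q z • action q z) := by
  have hw := orbitParam_pos hq hz
  rw [angle, add_sub_cancel_right, smul_smul, div_mul_div_cancel₀ hw.ne', div_self (by positivity),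
    one_smul]

lemma snd_eq (hq : 0 < q) (hz : 0 < ‖z.1‖) :
    z.2 = (orbitParam q z + 1)⁻¹ •
      (orbitParam q z • action q z - (speed q z / ‖z.1‖) • z.1) := by
  have hw := orbitParam_pos hq hz
  rw [orbitParam_smul_action hq hz, add_sub_cancel_right, inv_smul_smul₀ (by positivity)]

/-- The data are recovered in the order α, x × v, w, |x|, x, v, where w comes from strict
monotonicity of `timeFun`. -/
lemma actionAngle_injOn (hq : 0 < q) : InjOn (actionAngle q) physicalPhaseSpace := by
  intro z hz z' hz' h
  have hz : 0 < ‖z.1‖ := hz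
  have hz' : 0 < ‖z'.1‖ := hz'
  obtain ⟨hΘ, hA⟩ : angle q z = angle q z' ∧ action q z = action q z' := Prod.mk.inj h
  have hα : speed q z = speed q z' := by rw [← norm_action hq hz, hA, norm_action hq hz']
  have hL : cross z.1 z.2 = cross z'.1 z'.2 := by
    rw [← cross_angle_action hq hz, hΘ, hA, cross_angle_action hq hz']
  have hw : orbitParam q z = orbitParam q z' := by
    refine (timeFun_strictMonoOn hq (speed_pos hq hz) (sq_nonneg ‖cross z.1 z.2‖)).injOn
      (orbitParam_pos hq hz) (orbitParam_pos hq hz') ?_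
    rw [← inner_angle_action hq hz, hΘ, hA, inner_angle_action hq hz', hL, hα]
  have hr : ‖z.1‖ = ‖z'.1‖ := by rw [norm_fst_eq hq hz, norm_fst_eq hq hz', hα, hL, hw]
  have hμ : drift q z = drift q z' := by rw [drift, drift, hw, hα, hr]
  have hx : z.1 = z'.1 := by rw [fst_eq hq hz, fst_eq hq hz', hw, hμ, hΘ, hA]
  have hv : z.2 = z'.2 := by rw [snd_eq hq hz, snd_eq hq hz', hw, hA, hα, hx]
  exact Prod.ext hx hv

lemma actionAngle_mapsTo (hq : 0 < q) :
    MapsTo (actionAngle q) physicalPhaseSpace actionAnglePhaseSpace := by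
  intro z hz
  change 0 < ‖action q z‖
  rw [norm_action hq hz]
  exact speed_pos hq hz

lemma actionAngle_surjOn (hq : 0 < q) :
    SurjOn (actionAngle q) physicalPhaseSpace actionAnglePhaseSpace := by
  rintro ⟨ϑ, a⟩ ha
  have ha : 0 < ‖a‖ := ha
  set α := ‖a‖ with hαdef
  have haa : ⟪a, a⟫ = α ^ 2 := real_inner_self_eq_norm_sq a
  set l := ‖cross ϑ a‖ ^ 2 with hl
  obtain ⟨w, hw, hτ⟩ := exists_timeFun_eq hq ha (sq_nonneg ‖cross ϑ a‖) ⟪ϑ, a⟫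
  rw [← hl, timeFun] at hτ
  -- From here on r, μ, x, v are prescribed by the formulas that a preimage must satisfy
  -- (`norm_fst_eq`, `drift`, `fst_eq`, `snd_eq`); it remains to check consistency.
  set r := (l + q ^ 2 * (w + 1) ^ 2 / (4 * α ^ 2)) / (q * w) with hr
  have hr0 : 0 < r := by positivity
  have hlr : l = q * w * r - q ^ 2 * (w + 1) ^ 2 / (4 * α ^ 2) := by
    rw [hr]; field_simp; ring
  set μ := q * Real.log w / (2 * α ^ 3) - r / (α * (w + 1)) with hμ
  set x := ((w + 1) / w) • (ϑ - μ • a) with hx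
  set v := (w + 1)⁻¹ • (w • a - (α / r) • x) with hv
  have hxa : ⟪x, a⟫ = q * (w + 1) ^ 2 / (2 * α * w) - α * r := by
    rw [hx, inner_smul_left, inner_sub_left, inner_smul_left, ← hτ, haa, hlr, hμ]
    simp only [RCLike.conj_to_real]
    field_simp; ring
  have hcx : cross x a = ((w + 1) / w) • cross ϑ a := by
    rw [← cross_add_smul_self ϑ a _ (-((w + 1) / w * μ)), hx]
    congr 1
    module
  -- Lagrange's identity for x × a, with x × a and x·a already known, is an equation for |x|².
  have hnx : ‖x‖ = r := by
    have h1 := norm_cross_sq x a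
    rw [hcx, norm_smul, mul_pow, ← hl, hlr, hxa, Real.norm_of_nonneg (by positivity),
      ← hαdef] at h1
    have h2 : ‖x‖ ^ 2 = r ^ 2 := by
      have h3 : α ^ 2 ≠ 0 := by positivity
      apply mul_right_cancel₀ h3
      have h4 : ‖x‖ ^ 2 * α ^ 2 = _ := (eq_sub_iff_add_eq.1 h1).symm
      rw [h4]
      field_simp; ring
    exact (sq_eq_sq₀ (norm_nonneg _) hr0.le).1 h2
  have hxx : ⟪x, x⟫ = r ^ 2 := by rw [real_inner_self_eq_norm_sq, hnx]
  have hxv : ⟪x, v⟫ = q * (w + 1) / (2 * α) - α * r := by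
    rw [hv, inner_smul_right, inner_sub_right, inner_smul_right, inner_smul_right, hxx, hxa]
    field_simp; ring
  have hvv : ‖v‖ ^ 2 = α ^ 2 - q / r := by
    rw [← real_inner_self_eq_norm_sq, hv]
    simp only [inner_smul_right, inner_smul_left, inner_sub_right, inner_sub_left, hxx, hxa, haa,
      real_inner_comm x a, RCLike.conj_to_real]
    field_simp; ring
  have hs : speed q (x, v) = α := by
    rw [speed, energy, hvv, hnx, sub_add_cancel, Real.sqrt_sq ha.le]
  have hw' : orbitParam q (x, v) = w := by
    rw [orbitParam, hs, hxv, hnx]; field_simp; ring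
  have hA : action q (x, v) = a := by
    rw [action, hs, hw', hnx, hv, smul_inv_smul₀ (by positivity), sub_add_cancel,
      inv_smul_smul₀ hw.ne']
  have hμ' : drift q (x, v) = μ := by rw [drift, hs, hw', hnx]
  have hΘ : angle q (x, v) = ϑ := by
    rw [angle, hA, hμ', hw', hx, smul_smul, div_mul_div_cancel₀ (by positivity), div_self hw.ne',
      one_smul, sub_add_cancel]
  refine ⟨(x, v), ?_, Prod.ext hΘ hA⟩
  change 0 < ‖x‖
  rwa [hnx]

lemma actionAngle_bijOn (hq : 0 < q) :
    BijOn (actionAngle q) physicalPhaseSpace actionAnglePhaseSpace :=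
  ⟨actionAngle_mapsTo hq, actionAngle_injOn hq, actionAngle_surjOn hq⟩

/-! ### Smoothness -/

lemma isOpen_physicalPhaseSpace : IsOpen physicalPhaseSpace :=
  isOpen_lt continuous_const continuous_fst.norm

lemma isOpen_actionAnglePhaseSpace : IsOpen actionAnglePhaseSpace :=
  isOpen_lt continuous_const continuous_snd.norm

lemma eventually_norm_fst_pos (hz : 0 < ‖z.1‖) : ∀ᶠ y in 𝓝 z, 0 < ‖y.1‖ :=
  isOpen_physicalPhaseSpace.mem_nhds hz

lemma contDiffAt_norm_fst (hz : 0 < ‖z.1‖) : ContDiffAt ℝ ∞ (fun y : E3 × E3 => ‖y.1‖) z :=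
  contDiffAt_fst.norm ℝ (norm_pos_iff.1 hz)

lemma contDiffAt_speed (hq : 0 < q) (hz : 0 < ‖z.1‖) : ContDiffAt ℝ ∞ (speed q) z :=
  ((contDiffAt_snd.norm_sq ℝ).add
    (contDiffAt_const.div (contDiffAt_norm_fst hz) hz.ne')).sqrt (energy_pos hq hz).ne'

lemma contDiffAt_orbitParam (hq : 0 < q) (hz : 0 < ‖z.1‖) : ContDiffAt ℝ ∞ (orbitParam q) z :=
  (((contDiffAt_const.mul (contDiffAt_speed hq hz)).div_const q).mul
    ((contDiffAt_fst.inner ℝ contDiffAt_snd).add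
      ((contDiffAt_speed hq hz).mul (contDiffAt_norm_fst hz)))).sub contDiffAt_const

/-- The vector of length `√H` in the direction of `x`. -/
def radial (q : ℝ) (z : E3 × E3) : E3 := (speed q z / ‖z.1‖) • z.1

lemma contDiffAt_radial (hq : 0 < q) (hz : 0 < ‖z.1‖) : ContDiffAt ℝ ∞ (radial q) z :=
  ((contDiffAt_speed hq hz).div (contDiffAt_norm_fst hz) hz.ne').smul contDiffAt_fst

lemma contDiffAt_action (hq : 0 < q) (hz : 0 < ‖z.1‖) : ContDiffAt ℝ ∞ (action q) z :=
  ((contDiffAt_orbitParam hq hz).inv (orbitParam_pos hq hz).ne').smul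
    ((((contDiffAt_orbitParam hq hz).add contDiffAt_const).smul contDiffAt_snd).add
      (contDiffAt_radial hq hz))

lemma contDiffAt_drift (hq : 0 < q) (hz : 0 < ‖z.1‖) : ContDiffAt ℝ ∞ (drift q) z := by
  have hα := speed_pos hq hz
  have hw := orbitParam_pos hq hz
  exact ((contDiffAt_const.mul ((contDiffAt_orbitParam hq hz).log hw.ne')).div
      (contDiffAt_const.mul ((contDiffAt_speed hq hz).pow 3)) (by positivity)).sub
    ((contDiffAt_norm_fst hz).div ((contDiffAt_speed hq hz).mul
      ((contDiffAt_orbitParam hq hz).add contDiffAt_const)) (by positivity))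

lemma contDiffAt_angle (hq : 0 < q) (hz : 0 < ‖z.1‖) : ContDiffAt ℝ ∞ (angle q) z := by
  have hw := orbitParam_pos hq hz
  exact (((contDiffAt_orbitParam hq hz).div ((contDiffAt_orbitParam hq hz).add contDiffAt_const)
      (by positivity)).smul contDiffAt_fst).add
    ((contDiffAt_drift hq hz).smul (contDiffAt_action hq hz))

lemma contDiffAt_actionAngle (hq : 0 < q) (hz : 0 < ‖z.1‖) : ContDiffAt ℝ ∞ (actionAngle q) z :=
  (contDiffAt_angle hq hz).prodMk (contDiffAt_action hq hz)

/-! ### The map is canonical -/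

/-- The generating function as a function on the physical phase space, smooth across the fold. -/
def generatingValue (q : ℝ) (z : E3 × E3) : ℝ :=
  ⟪z.1, z.2⟫ - q / (2 * speed q z) * Real.log (orbitParam q z)

lemma contDiffAt_generatingValue (hq : 0 < q) (hz : 0 < ‖z.1‖) :
    ContDiffAt ℝ ∞ (generatingValue q) z := by
  have hα := speed_pos hq hz
  exact (contDiffAt_fst.inner ℝ contDiffAt_snd).sub ((contDiffAt_const.div
    (contDiffAt_const.mul (contDiffAt_speed hq hz)) (by positivity)).mul
      ((contDiffAt_orbitParam hq hz).log (orbitParam_pos hq hz).ne'))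

/-- Differentiate |f|² = α². This applies to both `action` and `radial`, the two vector fields of
length α. -/
lemma inner_fderiv_of_norm_eq_speed (hq : 0 < q) (hz : 0 < ‖z.1‖) {f : E3 × E3 → E3}
    (hf : DifferentiableAt ℝ f z) (h : ∀ᶠ y in 𝓝 z, ‖f y‖ = speed q y) (ξ : E3 × E3) :
    ⟪f z, fderiv ℝ f z ξ⟫ = speed q z * fderiv ℝ (speed q) z ξ := by
  have h1 : (fun y => ⟪f y, f y⟫) =ᶠ[𝓝 z] fun y => speed q y ^ 2 := by
    filter_upwards [h] with y hy
    rw [real_inner_self_eq_norm_sq, hy]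
  have hs := (contDiffAt_speed hq hz).differentiableAt (by simp)
  have h2 := congrArg (fun L => L ξ) (h1.fderiv_eq (𝕜 := ℝ))
  rw [fderiv_inner_apply ℝ hf hf, fderiv_fun_pow 2 hs] at h2
  rw [real_inner_comm (f z)] at h2
  simp at h2
  linarith

lemma norm_radial (hq : 0 < q) (hz : 0 < ‖z.1‖) : ‖radial q z‖ = speed q z := by
  have hα := speed_pos hq hz
  rw [radial, norm_smul, Real.norm_of_nonneg (by positivity), div_mul_cancel₀ _ hz.ne']

/-- The differential of the generating function is `v·dx + Θ·d𝒜`. -/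
lemma fderiv_generatingValue (hq : 0 < q) (hz : 0 < ‖z.1‖) (ξ : E3 × E3) :
    fderiv ℝ (generatingValue q) z ξ =
      ⟪z.2, ξ.1⟫ + ⟪angle q z, fderiv ℝ (action q) z ξ⟫ := by
  have hα := speed_pos hq hz
  have hw := orbitParam_pos hq hz
  have dα := (contDiffAt_speed hq hz).differentiableAt (by simp)
  have dw := (contDiffAt_orbitParam hq hz).differentiableAt (by simp)
  have dA := (contDiffAt_action hq hz).differentiableAt (by simp)
  have dB := (contDiffAt_radial hq hz).differentiableAt (by simp)
  set α' := fderiv ℝ (speed q) z ξ with hα'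
  set w' := fderiv ℝ (orbitParam q) z ξ with hw'
  set A' := fderiv ℝ (action q) z ξ with hA'
  set B' := fderiv ℝ (radial q) z ξ with hB'
  have hAA : ⟪action q z, A'⟫ = speed q z * α' :=
    inner_fderiv_of_norm_eq_speed hq hz dA
      ((eventually_norm_fst_pos hz).mono fun y hy => norm_action hq hy) ξ
  have hxB : ⟪z.1, B'⟫ = ‖z.1‖ * α' := by
    have h := inner_fderiv_of_norm_eq_speed hq hz dB
      ((eventually_norm_fst_pos hz).mono fun y hy => norm_radial hq hy) ξ
    rw [← hB', ← hα', radial, inner_smul_left] at h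
    simp only [RCLike.conj_to_real] at h
    field_simp at h
    linarith
  -- Differentiating the relation w𝒜 = (w + 1)v + αx/|x| and pairing with x expresses x·d𝒜 through
  -- dw and dα. Neither differential has to be computed, as both cancel at the end.
  have hrel : orbitParam q z • A' + w' • action q z =
      w' • z.2 + (orbitParam q z + 1) • ξ.2 + B' := by
    have h1 : (fun y => orbitParam q y • action q y) =ᶠ[𝓝 z]
        fun y => (orbitParam q y + 1) • y.2 + radial q y := by
      filter_upwards [eventually_norm_fst_pos hz] with y hy
      exact orbitParam_smul_action hq hy
    have hL := dw.hasFDerivAt.smul dA.hasFDerivAt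
    have hR := ((dw.hasFDerivAt.add_const 1).smul
      (hasFDerivAt_snd (𝕜 := ℝ) (p := z))).add dB.hasFDerivAt
    have h2 := congrArg (fun L => L ξ) (hL.unique (hR.congr_of_eventuallyEq h1))
    simp only [add_apply, smul_apply,
      ContinuousLinearMap.smulRight_apply, ContinuousLinearMap.coe_snd'] at h2
    rw [h2]
    abel
  have hxA' : orbitParam q z * ⟪z.1, A'⟫ + w' * ⟪z.1, action q z⟫ =
      w' * ⟪z.1, z.2⟫ + (orbitParam q z + 1) * ⟪z.1, ξ.2⟫ + ‖z.1‖ * α' := by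
    have h := congrArg (fun y => ⟪z.1, y⟫) hrel
    simpa only [inner_add_right, inner_smul_right, hxB] using h
  have hs : fderiv ℝ (generatingValue q) z ξ = ⟪z.1, ξ.2⟫ + ⟪ξ.1, z.2⟫
      + q * α' / (2 * speed q z ^ 2) * Real.log (orbitParam q z)
      - q / (2 * speed q z) * (w' / orbitParam q z) := by
    have h1 := (hasFDerivAt_fst (𝕜 := ℝ) (p := z)).inner ℝ (hasFDerivAt_snd (𝕜 := ℝ) (p := z))
    have h2 := (((hasDerivAt_inv hα.ne').comp_hasFDerivAt z dα.hasFDerivAt).const_mul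
      (q / 2)).mul (dw.hasFDerivAt.log hw.ne')
    have h3 : generatingValue q = fun y => ⟪y.1, y.2⟫ -
        q / 2 * (speed q y)⁻¹ * Real.log (orbitParam q y) := by
      funext y
      rw [generatingValue]
      ring
    have h4 : HasFDerivAt (generatingValue q) _ z :=
      (h1.sub h2).congr_of_eventuallyEq (Eventually.of_forall (congrFun h3))
    rw [h4.fderiv]
    simp [← hα', ← hw']
    field_simp
    ring
  rw [hs, angle, inner_add_left, inner_smul_left, inner_smul_left, hAA, drift,
    real_inner_comm z.2]
  simp only [RCLike.conj_to_real]
  rw [inner_fst_action hq hz, inner_eq hq hz] at hxA'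
  have hxA : ⟪z.1, A'⟫ = (w' * (q * (orbitParam q z + 1) / (2 * speed q z) - speed q z * ‖z.1‖)
      + (orbitParam q z + 1) * ⟪z.1, ξ.2⟫ + ‖z.1‖ * α' - w' * (q * (orbitParam q z + 1) ^ 2 /
        (2 * speed q z * orbitParam q z) - speed q z * ‖z.1‖)) / orbitParam q z := by
    rw [eq_div_iff hw.ne']
    linarith
  rw [hxA]
  field_simp
  ring

lemma canonicalForm_eq (ξ ζ : E3 × E3) :
    canonicalForm ξ ζ = ⟪ξ.1, ζ.2⟫ - ⟪ξ.2, ζ.1⟫ := by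
  simp only [canonicalForm, Fin.sum_univ_three, inner_eq_sum]
  ring

lemma fderiv_actionAngle (hq : 0 < q) (hz : 0 < ‖z.1‖) (ξ : E3 × E3) :
    fderiv ℝ (actionAngle q) z ξ = (fderiv ℝ (angle q) z ξ, fderiv ℝ (action q) z ξ) := by
  have h : HasFDerivAt (actionAngle q) _ z :=
    ((contDiffAt_angle hq hz).differentiableAt (by simp)).hasFDerivAt.prodMk
      ((contDiffAt_action hq hz).differentiableAt (by simp)).hasFDerivAt
  rw [h.fderiv]
  rfl

/-- A map `z = (x, v) ↦ (P, Q)` for which `v·dx + P·dQ` is exact is canonical. -/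
lemma canonicalForm_fderiv_of_exact {s : E3 × E3 → ℝ} {P Q : E3 × E3 → E3}
    (hs : ContDiffAt ℝ ∞ s z) (hP : ContDiffAt ℝ ∞ P z) (hQ : ContDiffAt ℝ ∞ Q z)
    (h : ∀ᶠ y in 𝓝 z, ∀ ξ, fderiv ℝ s y ξ = ⟪y.2, ξ.1⟫ + ⟪P y, fderiv ℝ Q y ξ⟫)
    (ξ ζ : E3 × E3) :
    canonicalForm (fderiv ℝ P z ξ, fderiv ℝ Q z ξ) (fderiv ℝ P z ζ, fderiv ℝ Q z ζ) =
      canonicalForm ξ ζ := by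
  have dP := hP.differentiableAt (by simp)
  have dds : DifferentiableAt ℝ (fderiv ℝ s) z :=
    (hs.fderiv_right (m := 1) (by norm_cast)).differentiableAt (by simp)
  have ddQ : DifferentiableAt ℝ (fderiv ℝ Q) z :=
    (hQ.fderiv_right (m := 1) (by norm_cast)).differentiableAt (by simp)
  -- This differentiates the one-form identity once more, in the direction ζ.
  have key : ∀ ξ ζ : E3 × E3, fderiv ℝ (fderiv ℝ s) z ζ ξ =
      ⟪ζ.2, ξ.1⟫ + (⟪P z, fderiv ℝ (fderiv ℝ Q) z ζ ξ⟫ +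
        ⟪fderiv ℝ P z ζ, fderiv ℝ Q z ξ⟫) := by
    intro ξ ζ
    have e : (fun y => fderiv ℝ s y ξ) =ᶠ[𝓝 z]
        fun y => ⟪y.2, ξ.1⟫ + ⟪P y, fderiv ℝ Q y ξ⟫ := h.mono fun y hy => hy ξ
    have h1 := dds.hasFDerivAt.clm_apply (hasFDerivAt_const ξ z)
    have h2 := ddQ.hasFDerivAt.clm_apply (hasFDerivAt_const ξ z)
    have h3 := ((hasFDerivAt_snd (𝕜 := ℝ) (p := z)).inner ℝ (hasFDerivAt_const ξ.1 z)).add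
      (dP.hasFDerivAt.inner ℝ h2)
    have h4 := congrArg (fun L => L ζ) (h1.unique (h3.congr_of_eventuallyEq e))
    simpa using h4
  have symS : IsSymmSndFDerivAt ℝ s z := hs.isSymmSndFDerivAt (by simp; norm_cast)
  have symQ : IsSymmSndFDerivAt ℝ Q z := hQ.isSymmSndFDerivAt (by simp; norm_cast)
  -- Antisymmetrizing in ξ, ζ removes the Hessians of s and Q, leaving only the two canonical forms.
  have h1 := key ξ ζ
  have h2 := key ζ ξ
  rw [symS ζ ξ, symQ ζ ξ] at h1
  rw [canonicalForm_eq, canonicalForm_eq]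
  simp only
  rw [real_inner_comm (fderiv ℝ P z ζ), real_inner_comm ζ.2]
  linarith

lemma canonicalForm_fderiv_actionAngle (hq : 0 < q) (hz : 0 < ‖z.1‖) (ξ ζ : E3 × E3) :
    canonicalForm (fderiv ℝ (actionAngle q) z ξ) (fderiv ℝ (actionAngle q) z ζ) =
      canonicalForm ξ ζ := by
  rw [fderiv_actionAngle hq hz, fderiv_actionAngle hq hz]
  exact canonicalForm_fderiv_of_exact (contDiffAt_generatingValue hq hz)
    (contDiffAt_angle hq hz) (contDiffAt_action hq hz)
    ((eventually_norm_fst_pos hz).mono fun y hy => fderiv_generatingValue hq hy) ξ ζ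

/-! ### Smoothness of the inverse -/

lemma eq_zero_of_canonicalForm {ξ : E3 × E3} (h : ∀ ζ, canonicalForm ξ ζ = 0) : ξ = 0 := by
  have h1 := h (0, ξ.1)
  have h2 := h (ξ.2, 0)
  rw [canonicalForm_eq] at h1 h2
  simp only [inner_zero_right, sub_zero, zero_sub, neg_eq_zero, inner_self_eq_zero] at h1 h2
  exact Prod.ext h1 h2

lemma injective_fderiv_actionAngle (hq : 0 < q) (hz : 0 < ‖z.1‖) :
    Function.Injective (fderiv ℝ (actionAngle q) z) := by
  rw [injective_iff_map_eq_zero]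
  intro ξ hξ
  refine eq_zero_of_canonicalForm fun ζ => ?_
  rw [← canonicalForm_fderiv_actionAngle hq hz, hξ, canonicalForm_eq]
  simp

/-- The derivative of the action-angle map as a linear equivalence. -/
def fderivEquiv (hq : 0 < q) (hz : 0 < ‖z.1‖) : (E3 × E3) ≃L[ℝ] (E3 × E3) :=
  (LinearEquiv.ofInjectiveEndo (fderiv ℝ (actionAngle q) z : (E3 × E3) →ₗ[ℝ] (E3 × E3))
    (injective_fderiv_actionAngle hq hz)).toContinuousLinearEquiv

lemma hasFDerivAt_actionAngle (hq : 0 < q) (hz : 0 < ‖z.1‖) :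
    HasFDerivAt (actionAngle q) (fderivEquiv hq hz : (E3 × E3) →L[ℝ] (E3 × E3)) z :=
  ((contDiffAt_actionAngle hq hz).differentiableAt (by simp)).hasFDerivAt

/-- The action-angle map as a bijection between the two phase spaces. -/
def actionAngleEquiv (q : ℝ) (hq : 0 < q) : PartialEquiv (E3 × E3) (E3 × E3) :=
  (actionAngle_bijOn hq).toPartialEquiv (actionAngle q) _ _

lemma coe_actionAngleEquiv (hq : 0 < q) : ⇑(actionAngleEquiv q hq) = actionAngle q := rfl

lemma actionAngle_symm (hq : 0 < q) {y : E3 × E3} (hy : 0 < ‖y.2‖) :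
    0 < ‖((actionAngleEquiv q hq).symm y).1‖ ∧
      actionAngle q ((actionAngleEquiv q hq).symm y) = y :=
  ⟨(actionAngleEquiv q hq).map_target hy, (actionAngleEquiv q hq).right_inv hy⟩

lemma symm_actionAngle (hq : 0 < q) (hz : 0 < ‖z.1‖) :
    (actionAngleEquiv q hq).symm (actionAngle q z) = z :=
  (actionAngleEquiv q hq).left_inv hz

lemma contDiffAt_symm (hq : 0 < q) {y : E3 × E3} (hy : 0 < ‖y.2‖) :
    ContDiffAt ℝ ∞ (actionAngleEquiv q hq).symm y := by
  obtain ⟨hz, hzy⟩ := actionAngle_symm hq hy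
  set z := (actionAngleEquiv q hq).symm y
  have hT := contDiffAt_actionAngle hq hz
  have hT' := hasFDerivAt_actionAngle hq hz
  have hloc := hT.to_localInverse hT' (by simp)
  have hst := hT.hasStrictFDerivAt' hT' (by simp)
  rw [← hzy]
  refine hloc.congr_of_eventuallyEq ?_
  -- The local inverse must land where |x| > 0: only there does injectivity identify it with the
  -- global inverse.
  have hmem : ∀ᶠ u in 𝓝 (actionAngle q z), 0 < ‖(hT.localInverse hT' (by simp) u).1‖ := by
    have hc := hloc.continuousAt
    refine hc.eventually (isOpen_physicalPhaseSpace.mem_nhds ?_)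
    rw [ContDiffAt.localInverse_apply_image]
    exact hz
  filter_upwards [hmem, hst.eventually_right_inverse] with u hu hu'
  have hu'' : actionAngle q (hT.localInverse hT' (by simp) u) = u := hu'
  conv_lhs => rw [← hu'']
  exact symm_actionAngle hq hu

/-! ### Linearization of the flow -/

lemma norm_mul_fderiv_norm_fst (hz : 0 < ‖z.1‖) (ζ : E3 × E3) :
    ‖z.1‖ * fderiv ℝ (fun y : E3 × E3 => ‖y.1‖) z ζ = ⟪z.1, ζ.1⟫ := by
  have hr := (contDiffAt_norm_fst hz).differentiableAt (by simp)
  have h1 : (fun y : E3 × E3 => ‖y.1‖ ^ 2) = fun y => ⟪y.1, y.1⟫ := by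
    funext y
    rw [real_inner_self_eq_norm_sq]
  have h2 := congrArg (fun f => fderiv ℝ f z ζ) h1
  rw [fderiv_inner_apply ℝ differentiableAt_fst differentiableAt_fst, fderiv_fun_pow 2 hr,
    fderiv_fst, ContinuousLinearMap.coe_fst', real_inner_comm z.1 ζ.1] at h2
  simp at h2
  linarith

lemma speed_mul_fderiv_speed (hq : 0 < q) (hz : 0 < ‖z.1‖) (ζ : E3 × E3) :
    speed q z * fderiv ℝ (speed q) z ζ = ⟪z.2, ζ.2⟫ - q / 2 / ‖z.1‖ ^ 3 * ⟪z.1, ζ.1⟫ := by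
  have hr := (contDiffAt_norm_fst hz).differentiableAt (by simp)
  have hs := (contDiffAt_speed hq hz).differentiableAt (by simp)
  have h1 : (fun y => speed q y ^ 2) =ᶠ[𝓝 z]
      fun y => ⟪y.2, y.2⟫ + q * ‖y.1‖⁻¹ := by
    filter_upwards [eventually_norm_fst_pos hz] with y hy
    rw [real_inner_self_eq_norm_sq, speed_sq hq hy, div_eq_mul_inv]
  have h2 := (hs.hasFDerivAt.pow 2)
  have h3 := ((hasFDerivAt_snd (𝕜 := ℝ) (p := z)).inner ℝ
    (hasFDerivAt_snd (𝕜 := ℝ) (p := z))).add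
    (((hasDerivAt_inv hz.ne').comp_hasFDerivAt z hr.hasFDerivAt).const_mul q)
  have h4 := congrArg (fun L => L ζ) (h2.unique (h3.congr_of_eventuallyEq h1))
  simp [real_inner_comm z.2 ζ.2] at h4
  rw [← norm_mul_fderiv_norm_fst hz]
  field_simp at h4 ⊢
  linarith

/-- The vector field of the repulsive Kepler system. -/
def keplerField (q : ℝ) (z : E3 × E3) : E3 × E3 := (z.2, (q / 2 / ‖z.1‖ ^ 3) • z.1)

/-- The derivative of the action-angle map sends the Kepler vector field to `(𝒜, 0)`. -/
lemma fderiv_actionAngle_keplerField (hq : 0 < q) (hz : 0 < ‖z.1‖) :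
    fderiv ℝ (actionAngle q) z (keplerField q z) = (action q z, 0) := by
  -- Let X be the preimage of (𝒜, 0) under DT. Canonicity turns its pairing with ζ into 𝒜·d𝒜(ζ) = α
  -- dα(ζ) = dH(ζ)/2, which is also the pairing of the Kepler field with ζ; nondegeneracy concludes.
  obtain ⟨X, hX⟩ : ∃ X, fderiv ℝ (actionAngle q) z X = (action q z, 0) :=
    (fderivEquiv hq hz).surjective _
  suffices X - keplerField q z = 0 by rw [← hX, sub_eq_zero.1 this]
  refine eq_zero_of_canonicalForm fun ζ => ?_
  have h1 := canonicalForm_fderiv_actionAngle hq hz X ζ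
  rw [hX, fderiv_actionAngle hq hz, canonicalForm_eq, canonicalForm_eq] at h1
  simp only [inner_zero_left, sub_zero] at h1
  rw [inner_fderiv_of_norm_eq_speed hq hz
    ((contDiffAt_action hq hz).differentiableAt (by simp))
    ((eventually_norm_fst_pos hz).mono fun y hy => norm_action hq hy),
    speed_mul_fderiv_speed hq hz] at h1
  rw [canonicalForm_eq]
  simp only [keplerField, Prod.fst_sub, Prod.snd_sub, inner_sub_left, inner_smul_left,
    RCLike.conj_to_real]
  linarith

lemma eq_of_hasDerivWithinAt_zero {I : Set ℝ} (hI : I.OrdConnected) {f : ℝ → E3}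
    (hf : ∀ t ∈ I, HasDerivWithinAt f 0 I t) {s t : ℝ} (hs : s ∈ I) (ht : t ∈ I) :
    f t = f s := by
  have h := hI.convex.norm_image_sub_le_of_norm_hasDerivWithin_le (C := 0) hf (by simp) hs ht
  rw [zero_mul] at h
  exact sub_eq_zero.1 (norm_le_zero_iff.1 h)

/-- The flow in action-angle variables along a solution. -/
lemma actionAngle_of_solvesKeplerOn (hq : 0 < q) {I : Set ℝ} (hI : I.OrdConnected)
    (h0 : (0 : ℝ) ∈ I) {x v : ℝ → E3} (hx : ∀ t ∈ I, 0 < ‖x t‖)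
    (h : SolvesKeplerOn q I x v) {t : ℝ} (ht : t ∈ I) :
    angle q (x t, v t) = angle q (x 0, v 0) + t • action q (x 0, v 0) ∧
      action q (x t, v t) = action q (x 0, v 0) := by
  have hd : ∀ t ∈ I, HasDerivWithinAt (fun t => actionAngle q (x t, v t))
      (action q (x t, v t), 0) I t := by
    intro t ht
    have h1 : HasDerivWithinAt (fun t => (x t, v t)) (keplerField q (x t, v t)) I t :=
      (h t ht).1.prodMk (h t ht).2
    have hz : 0 < ‖(x t, v t).1‖ := hx t ht
    have h2 := ((contDiffAt_actionAngle hq hz).differentiableAt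
      (by simp)).hasFDerivAt.comp_hasDerivWithinAt t h1
    rwa [fderiv_actionAngle_keplerField hq hz] at h2
  have hA : ∀ t ∈ I, action q (x t, v t) = action q (x 0, v 0) := fun t ht =>
    eq_of_hasDerivWithinAt_zero hI
      (fun s hs => (ContinuousLinearMap.snd ℝ E3 E3).hasFDerivAt.comp_hasDerivWithinAt s
        (hd s hs)) h0 ht
  refine ⟨?_, hA t ht⟩
  have hΘ := eq_of_hasDerivWithinAt_zero hI
    (f := fun t => angle q (x t, v t) - t • action q (x 0, v 0)) (fun s hs => ?_) h0 ht
  · simp only [zero_smul, sub_zero] at hΘ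
    rw [← hΘ, sub_add_cancel]
  · have h1 : HasDerivWithinAt (fun t => angle q (x t, v t)) (action q (x s, v s)) I s :=
      (ContinuousLinearMap.fst ℝ E3 E3).hasFDerivAt.comp_hasDerivWithinAt s (hd s hs)
    have h2 := h1.sub ((hasDerivWithinAt_id s I).smul_const (action q (x 0, v 0)))
    rw [one_smul, hA s hs, sub_self] at h2
    exact h2

/-- The inverse of the action-angle map sends uniform motions to solutions. -/
lemma hasDerivAt_symm (hq : 0 < q) {ϑ a : E3} (ha : 0 < ‖a‖) (t : ℝ) :
    HasDerivAt (fun t : ℝ => (actionAngleEquiv q hq).symm (ϑ + t • a, a))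
      (keplerField q ((actionAngleEquiv q hq).symm (ϑ + t • a, a))) t := by
  have hc : HasDerivAt (fun t : ℝ => (ϑ + t • a, a)) (a, (0 : E3)) t := by
    have h := (((hasDerivAt_id t).smul_const a).const_add ϑ).prodMk (hasDerivAt_const t a)
    rwa [one_smul] at h
  have hy : 0 < ‖(ϑ + t • a, a).2‖ := ha
  obtain ⟨hz, hzy⟩ := actionAngle_symm hq hy
  have hS := ((contDiffAt_symm hq hy).differentiableAt (by simp)).hasFDerivAt
  have h1 := hS.comp_hasDerivAt t hc
  suffices e : keplerField q ((actionAngleEquiv q hq).symm (ϑ + t • a, a)) =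
      fderiv ℝ (actionAngleEquiv q hq).symm (ϑ + t • a, a) (a, 0) by rw [e]; exact h1
  -- Both sides have image (a, 0) under the injective map DT: one because the Kepler field is
  -- straightened, the other because T ∘ T⁻¹ is locally the identity.
  apply injective_fderiv_actionAngle hq hz
  rw [fderiv_actionAngle_keplerField hq hz, show action q _ = a from congrArg Prod.snd hzy]
  have hT := ((contDiffAt_actionAngle hq hz).differentiableAt (by simp)).hasFDerivAt.comp _ hS
  have hid : (actionAngle q ∘ (actionAngleEquiv q hq).symm) =ᶠ[𝓝 (ϑ + t • a, a)] id := by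
    filter_upwards [isOpen_actionAnglePhaseSpace.mem_nhds hy] with u hu
    exact (actionAngle_symm hq hu).2
  have h2 := hT.unique ((hasFDerivAt_id _).congr_of_eventuallyEq hid)
  exact (congrArg (fun L => L (a, (0 : E3))) h2).symm

lemma solvesKeplerOn_of_actionAngle (hq : 0 < q) {I : Set ℝ} (h0 : (0 : ℝ) ∈ I)
    {x v : ℝ → E3} (hx : ∀ t ∈ I, 0 < ‖x t‖)
    (h : ∀ t ∈ I, angle q (x t, v t) = angle q (x 0, v 0) + t • action q (x 0, v 0) ∧
      action q (x t, v t) = action q (x 0, v 0)) :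
    SolvesKeplerOn q I x v := by
  have ha : 0 < ‖action q (x 0, v 0)‖ := actionAngle_mapsTo hq (hx 0 h0)
  have hxv : ∀ t ∈ I, (x t, v t) = (actionAngleEquiv q hq).symm
      (angle q (x 0, v 0) + t • action q (x 0, v 0), action q (x 0, v 0)) := by
    intro t ht
    have hz : 0 < ‖(x t, v t).1‖ := hx t ht
    conv_lhs => rw [← symm_actionAngle hq hz]
    congr 1
    exact Prod.ext (h t ht).1 (h t ht).2
  intro t ht
  have h1 : HasDerivWithinAt (fun t => (x t, v t)) (keplerField q (x t, v t)) I t := by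
    rw [hxv t ht]
    exact (hasDerivAt_symm hq ha t).hasDerivWithinAt.congr hxv (hxv t ht)
  exact ⟨(ContinuousLinearMap.fst ℝ E3 E3).hasFDerivAt.comp_hasDerivWithinAt t h1,
    (ContinuousLinearMap.snd ℝ E3 E3).hasFDerivAt.comp_hasDerivWithinAt t h1⟩

/-! ### The asymptotic action property -/

lemma cross_add_smul_right (ϑ a : E3) (t : ℝ) : cross (ϑ + t • a) a = cross ϑ a := by
  have h := cross_add_smul_self ϑ a 1 t
  rwa [one_smul, one_smul] at h

/-- Along the preimage of a uniform motion, the orbit parameter is given by the time. -/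
lemma timeFun_orbitParam_symm (hq : 0 < q) (ϑ : E3) {a : E3} (ha : 0 < ‖a‖) (t : ℝ) :
    timeFun q ‖a‖ (‖cross ϑ a‖ ^ 2)
      (orbitParam q ((actionAngleEquiv q hq).symm (ϑ + t • a, a))) =
        ⟪ϑ, a⟫ + t * ‖a‖ ^ 2 := by
  have hy : 0 < ‖(ϑ + t • a, a).2‖ := ha
  obtain ⟨hz, hzy⟩ := actionAngle_symm hq hy
  obtain ⟨hΘ, hA⟩ := Prod.mk.inj hzy
  have h := inner_angle_action hq hz
  rw [← cross_angle_action hq hz, ← norm_action hq hz, hΘ, hA, cross_add_smul_right] at h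
  rw [← h, inner_add_left, inner_smul_left, real_inner_self_eq_norm_sq]
  simp

lemma tendsto_orbitParam_symm (hq : 0 < q) (ϑ : E3) {a : E3} (ha : 0 < ‖a‖) :
    Tendsto (fun t : ℝ => orbitParam q ((actionAngleEquiv q hq).symm (ϑ + t • a, a)))
      atTop atTop := by
  rw [tendsto_atTop]
  intro M
  have hlim : Tendsto (fun t : ℝ => ⟪ϑ, a⟫ + t * ‖a‖ ^ 2) atTop atTop :=
    tendsto_atTop_add_const_left _ _ (tendsto_id.atTop_mul_const (by positivity))
  -- The maximum with 1 keeps the comparison point in (0, ∞), where `timeFun` is monotone.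
  filter_upwards [hlim.eventually_gt_atTop (timeFun q ‖a‖ (‖cross ϑ a‖ ^ 2) (max M 1))]
    with t ht
  rw [← timeFun_orbitParam_symm hq ϑ ha t] at ht
  have hpos : 0 < orbitParam q ((actionAngleEquiv q hq).symm (ϑ + t • a, a)) :=
    orbitParam_pos hq (actionAngle_symm hq (y := (ϑ + t • a, a)) ha).1
  have h := ((timeFun_strictMonoOn hq ha (sq_nonneg ‖cross ϑ a‖)).lt_iff_lt
    (mem_Ioi.2 (lt_max_of_lt_right one_pos)) hpos).1 ht
  exact (le_max_left M 1).trans h.le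

lemma norm_snd_sub_action_le (hq : 0 < q) (hz : 0 < ‖z.1‖) :
    ‖z.2 - action q z‖ ≤ 2 * speed q z * (orbitParam q z + 1)⁻¹ := by
  have hw := orbitParam_pos hq hz
  have h : z.2 - action q z = (orbitParam q z + 1)⁻¹ • (-action q z - radial q z) := by
    have h1 : action q z =
        (orbitParam q z + 1)⁻¹ • ((orbitParam q z + 1) • action q z) := by
      rw [inv_smul_smul₀ (by positivity)]
    conv_lhs => rw [snd_eq hq hz, h1, ← smul_sub, ← h1]
    congr 1
    rw [radial]
    module
  rw [h, norm_smul, Real.norm_of_nonneg (by positivity), mul_comm]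
  gcongr
  refine (norm_sub_le _ _).trans ?_
  rw [norm_neg, norm_action hq hz, norm_radial hq hz]
  linarith

/-- Since |x| grows only linearly in w, the part x/(w + 1) of x missing from Θ stays bounded. -/
lemma norm_fst_div_le (hq : 0 < q) (hz : 0 < ‖z.1‖) (hw : 1 ≤ orbitParam q z) :
    ‖z.1‖ / (orbitParam q z + 1) ≤
      ‖cross z.1 z.2‖ ^ 2 / q + q / (2 * speed q z ^ 2) := by
  have hα := speed_pos hq hz
  have h := norm_fst_eq hq hz
  set w := orbitParam q z
  set l := ‖cross z.1 z.2‖ ^ 2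
  have hl : 0 ≤ l := sq_nonneg _
  have e : ‖z.1‖ / (w + 1) =
      l / q * (1 / (w * (w + 1))) + q / (2 * speed q z ^ 2) * ((w + 1) / (2 * w)) := by
    rw [h]; field_simp; ring
  have h1 : 1 / (w * (w + 1)) ≤ 1 := by
    rw [div_le_one (by positivity)]; nlinarith
  have h2 : (w + 1) / (2 * w) ≤ 1 := by
    rw [div_le_one (by positivity)]; linarith
  rw [e]
  exact add_le_add (mul_le_of_le_one_right (by positivity) h1)
    (mul_le_of_le_one_right (by positivity) h2)

/-- Here x - t𝒜 = x/(w + 1) - μ𝒜 + ϑ with μ the drift, and the only unbounded contribution is the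
logarithm in μ. -/
lemma norm_fst_sub_le (hq : 0 < q) (hz : 0 < ‖z.1‖) (hw : 1 ≤ orbitParam q z) (ϑ : E3) (t : ℝ)
    (h : angle q z = ϑ + t • action q z) :
    ‖z.1 - t • action q z‖ ≤
      2 * (‖cross z.1 z.2‖ ^ 2 / q + q / (2 * speed q z ^ 2)) + ‖ϑ‖ +
        q / (2 * speed q z ^ 2) * Real.log (orbitParam q z) := by
  have hα := speed_pos hq hz
  have hbd := norm_fst_div_le hq hz hw
  have hlog := Real.log_nonneg hw
  have hw' : orbitParam q z + 1 ≠ 0 := by positivity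
  have e : z.1 - t • action q z =
      (orbitParam q z + 1)⁻¹ • z.1 - drift q z • action q z + ϑ := by
    have h1 : (orbitParam q z + 1)⁻¹ • z.1 =
        z.1 - (orbitParam q z / (orbitParam q z + 1)) • z.1 := by
      rw [eq_sub_iff_add_eq, ← add_smul]
      convert one_smul ℝ _
      field_simp
      ring
    have h2 : t • action q z = angle q z - ϑ := by rw [h]; abel
    rw [h1, h2, angle]
    abel
  have h1 : ‖(orbitParam q z + 1)⁻¹ • z.1‖ = ‖z.1‖ / (orbitParam q z + 1) := by
    rw [norm_smul, Real.norm_of_nonneg (by positivity), div_eq_inv_mul]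
  have h2 : ‖drift q z • action q z‖ ≤ q / (2 * speed q z ^ 2) * Real.log (orbitParam q z)
      + ‖z.1‖ / (orbitParam q z + 1) := by
    have h3 : |drift q z| ≤ q * Real.log (orbitParam q z) / (2 * speed q z ^ 3)
        + ‖z.1‖ / (speed q z * (orbitParam q z + 1)) := by
      rw [drift]
      refine (abs_sub _ _).trans (le_of_eq ?_)
      rw [abs_of_nonneg (by positivity), abs_of_nonneg (by positivity)]
    rw [norm_smul, norm_action hq hz, Real.norm_eq_abs]
    refine (mul_le_mul_of_nonneg_right h3 hα.le).trans (le_of_eq ?_)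
    field_simp
  rw [e]
  refine (norm_add_le _ _).trans ?_
  have h4 := norm_sub_le ((orbitParam q z + 1)⁻¹ • z.1) (drift q z • action q z)
  linarith

lemma isBigO_orbitParam_symm (hq : 0 < q) (ϑ : E3) {a : E3} (ha : 0 < ‖a‖) :
    (fun t : ℝ => orbitParam q ((actionAngleEquiv q hq).symm (ϑ + t • a, a)))
      =O[atTop] (fun t : ℝ => t) := by
  set l := ‖cross ϑ a‖ ^ 2 with hl
  have hl0 : 0 ≤ l := sq_nonneg _
  have hO : (fun t : ℝ => (1 + 4 * ‖a‖ / q * (⟪ϑ, a⟫ + ‖a‖ * l / q))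
      + 4 * ‖a‖ ^ 3 / q * t) =O[atTop] (fun t : ℝ => t) :=
    (isLittleO_const_id_atTop _).isBigO.add (isBigO_const_mul_self _ _ _)
  refine IsBigO.trans (IsBigO.of_bound 1 ?_) hO
  filter_upwards [(tendsto_orbitParam_symm hq ϑ ha).eventually_ge_atTop 1] with t ht
  have h := timeFun_orbitParam_symm hq ϑ ha t
  rw [← hl] at h
  set w := orbitParam q ((actionAngleEquiv q hq).symm (ϑ + t • a, a))
  have hinv := inv_le_one_of_one_le₀ ht
  have hlog : 0 ≤ q / (2 * ‖a‖) * Real.log w :=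
    mul_nonneg (by positivity) (Real.log_nonneg ht)
  -- For w ≥ 1 the logarithm is nonnegative and 1/w ≤ 1, so `timeFun` dominates a linear function of
  -- w.
  have h1 : q / (4 * ‖a‖) * (w - 1) ≤ q / (4 * ‖a‖) * (w - w⁻¹) := by gcongr
  have h2 : ‖a‖ * l / q * w⁻¹ ≤ ‖a‖ * l / q :=
    mul_le_of_le_one_right (by positivity) hinv
  have h3 : q / (4 * ‖a‖) * (w - 1) ≤ ⟪ϑ, a⟫ + t * ‖a‖ ^ 2 + ‖a‖ * l / q := by
    rw [timeFun] at h
    linarith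
  have h4 : w - 1 ≤ 4 * ‖a‖ / q * (⟪ϑ, a⟫ + t * ‖a‖ ^ 2 + ‖a‖ * l / q) := by
    calc w - 1 = 4 * ‖a‖ / q * (q / (4 * ‖a‖) * (w - 1)) := by field_simp
      _ ≤ _ := by gcongr
  rw [one_mul, Real.norm_of_nonneg (by linarith)]
  refine le_trans ?_ (le_abs_self _)
  calc w ≤ 1 + 4 * ‖a‖ / q * (⟪ϑ, a⟫ + t * ‖a‖ ^ 2 + ‖a‖ * l / q) := by linarith
    _ = _ := by ring

lemma isLittleO_fst_symm (hq : 0 < q) (ϑ : E3) {a : E3} (ha : 0 < ‖a‖) :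
    (fun t : ℝ => ‖((actionAngleEquiv q hq).symm (ϑ + t • a, a)).1 - t • a‖)
      =o[atTop] (fun t : ℝ => t) := by
  have hlog : (fun t : ℝ =>
      Real.log (orbitParam q ((actionAngleEquiv q hq).symm (ϑ + t • a, a))))
        =o[atTop] (fun t : ℝ => t) :=
    (Real.isLittleO_log_id_atTop.comp_tendsto (tendsto_orbitParam_symm hq ϑ ha)).trans_isBigO
      (isBigO_orbitParam_symm hq ϑ ha)
  have ho : (fun t : ℝ => 2 * (‖cross ϑ a‖ ^ 2 / q + q / (2 * ‖a‖ ^ 2)) + ‖ϑ‖ +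
      q / (2 * ‖a‖ ^ 2) *
        Real.log (orbitParam q ((actionAngleEquiv q hq).symm (ϑ + t • a, a))))
          =o[atTop] (fun t : ℝ => t) :=
    (isLittleO_const_id_atTop _).add (hlog.const_mul_left _)
  refine IsBigO.trans_isLittleO (IsBigO.of_bound 1 ?_) ho
  filter_upwards [(tendsto_orbitParam_symm hq ϑ ha).eventually_ge_atTop 1] with t ht
  obtain ⟨hz, hzy⟩ := actionAngle_symm hq (y := (ϑ + t • a, a)) ha
  obtain ⟨hΘ, hA⟩ := Prod.mk.inj hzy
  have h := norm_fst_sub_le hq hz ht ϑ t (by rw [hΘ, hA])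
  rw [← cross_angle_action hq hz, ← norm_action hq hz, hΘ, hA, cross_add_smul_right] at h
  rw [norm_norm, one_mul]
  exact h.trans (le_abs_self _)

lemma isLittleO_snd_symm (hq : 0 < q) (ϑ : E3) {a : E3} (ha : 0 < ‖a‖) :
    (fun t : ℝ => ‖((actionAngleEquiv q hq).symm (ϑ + t • a, a)).2 - a‖)
      =o[atTop] (fun _ : ℝ => (1 : ℝ)) := by
  rw [isLittleO_one_iff]
  have hlim : Tendsto (fun t : ℝ => 2 * ‖a‖ *
      (orbitParam q ((actionAngleEquiv q hq).symm (ϑ + t • a, a)) + 1)⁻¹) atTop (𝓝 0) := by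
    have h := (tendsto_atTop_add_const_right _ 1
      (tendsto_orbitParam_symm hq ϑ ha)).inv_tendsto_atTop.const_mul (2 * ‖a‖)
    rwa [mul_zero] at h
  refine squeeze_zero (fun t => norm_nonneg _) (fun t => ?_) hlim
  obtain ⟨hz, hzy⟩ := actionAngle_symm hq (y := (ϑ + t • a, a)) ha
  obtain ⟨-, hA⟩ := Prod.mk.inj hzy
  have h := norm_snd_sub_action_le hq hz
  rwa [← norm_action hq hz, hA] at h

/-! ### The generating functions -/

lemma rho_action (hq : 0 < q) (hz : 0 < ‖z.1‖) :
    rho q z.1 (action q z) = (orbitParam q z + 1) ^ 2 / (4 * orbitParam q z) := by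
  have hα := speed_pos hq hz
  have hw := orbitParam_pos hq hz
  rw [rho, norm_action hq hz, inner_fst_action hq hz]
  field_simp; ring

lemma rho_action_sub_one (hq : 0 < q) (hz : 0 < ‖z.1‖) :
    rho q z.1 (action q z) - 1 = (orbitParam q z - 1) ^ 2 / (4 * orbitParam q z) := by
  have hw := orbitParam_pos hq hz
  rw [rho_action hq hz]
  field_simp; ring

/-- The fold function has the sign of `w - 1`. -/
lemma exists_foldFunction_eq (hq : 0 < q) (hz : 0 < ‖z.1‖) :
    ∃ c, 0 < c ∧ foldFunction q z.1 z.2 = c * (orbitParam q z - 1) := by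
  have hα := speed_pos hq hz
  have hw := orbitParam_pos hq hz
  refine ⟨speed q z * ‖z.1‖ - q * (orbitParam q z + 1) / (4 * speed q z), ?_, ?_⟩
  -- Rewriting the factor through |x × v|² exhibits it as a sum of a nonnegative and a positive
  -- term.
  · have h : speed q z * ‖z.1‖ - q * (orbitParam q z + 1) / (4 * speed q z) =
        (speed q z * ‖cross z.1 z.2‖ ^ 2 + q ^ 2 * (orbitParam q z + 1) / (4 * speed q z)) /
          (q * orbitParam q z) := by
      rw [norm_cross_sq_eq hq hz]
      field_simp; ring
    rw [h]
    positivity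
  · change ⟪z.1, z.2⟫ + speed q z * ‖cross z.1 z.2‖ ^ 2 / q = _
    rw [norm_cross_sq_eq hq hz, inner_eq hq hz]
    field_simp; ring

lemma foldFunction_neg_iff (hq : 0 < q) (hz : 0 < ‖z.1‖) :
    foldFunction q z.1 z.2 < 0 ↔ orbitParam q z < 1 := by
  obtain ⟨c, hc, h⟩ := exists_foldFunction_eq hq hz
  rw [h, ← neg_pos, ← mul_neg, mul_pos_iff_of_pos_left hc, neg_sub, sub_pos]

lemma foldFunction_pos_iff (hq : 0 < q) (hz : 0 < ‖z.1‖) :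
    0 < foldFunction q z.1 z.2 ↔ 1 < orbitParam q z := by
  obtain ⟨c, hc, h⟩ := exists_foldFunction_eq hq hz
  rw [h, mul_pos_iff_of_pos_left hc, sub_pos]

lemma one_le_rho_action (hq : 0 < q) (hz : 0 < ‖z.1‖) : 1 ≤ rho q z.1 (action q z) := by
  have hw := orbitParam_pos hq hz
  rw [← sub_nonneg, rho_action_sub_one hq hz]
  positivity

lemma rho_action_eq_one_iff (hq : 0 < q) (hz : 0 < ‖z.1‖) :
    rho q z.1 (action q z) = 1 ↔ foldFunction q z.1 z.2 = 0 := by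
  have hw := orbitParam_pos hq hz
  obtain ⟨c, hc, h⟩ := exists_foldFunction_eq hq hz
  rw [h, ← sub_eq_zero, rho_action_sub_one hq hz]
  simp [hc.ne', hw.ne']

lemma hasDerivAt_K {s : ℝ} (hs : 1 < s) : HasDerivAt K (√(s - 1) / √s) s := by
  have hs0 : 0 < s := one_pos.trans hs
  have hs1 : 0 < s - 1 := sub_pos.2 hs
  have ha : 0 < √s := Real.sqrt_pos.2 hs0
  have hb : 0 < √(s - 1) := Real.sqrt_pos.2 hs1
  have d1 : HasDerivAt (fun s : ℝ => s - 1) 1 s := (hasDerivAt_id s).sub_const 1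
  have h1 := ((hasDerivAt_id s).mul d1).sqrt (mul_pos hs0 hs1).ne'
  have h2 := (((hasDerivAt_id s).sqrt hs0.ne').add (d1.sqrt hs1.ne')).log (by
    simp only [Pi.add_apply, id]; positivity)
  have h3 : HasDerivAt K _ s := h1.sub h2
  convert h3 using 1
  simp only [Pi.add_apply, Pi.mul_apply, id, one_mul, mul_one, Real.sqrt_mul hs0.le]
  field_simp
  rw [Real.sq_sqrt hs1.le]
  ring

variable {ι w : ℝ}

lemma sqrt_sq_div_four_mul (w : ℝ) {c : ℝ} (hc : 0 ≤ c) :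
    √(c ^ 2 / (4 * w)) = c / (2 * √w) := by
  rw [Real.sqrt_div (sq_nonneg _), Real.sqrt_sq hc, Real.sqrt_mul (by norm_num),
    show (4 : ℝ) = 2 ^ 2 by norm_num, Real.sqrt_sq (by norm_num)]

/-- As ι is the sign of w - 1, √(s - 1) = ι(w - 1)/(2√w). Hence √s + √(s - 1) is √w or 1/√w, and the
factor ι undoes this choice: both branches give one formula. -/
lemma mul_K_eq (hw : 0 < w) {s : ℝ} (hs : s = (w + 1) ^ 2 / (4 * w))
    (hι : ι = 1 ∨ ι = -1) (hwι : 0 < ι * (w - 1)) :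
    ι * K s = (w - w⁻¹) / 4 - Real.log w / 2 := by
  have hw1 : √w ≠ 0 := (Real.sqrt_pos.2 hw).ne'
  have hsq : √w ^ 2 = w := Real.sq_sqrt hw.le
  have hs1 : s - 1 = (ι * (w - 1)) ^ 2 / (4 * w) := by
    have : ι ^ 2 = 1 := by rcases hι with rfl | rfl <;> norm_num
    rw [hs, mul_pow, this]; field_simp; ring
  have e1 : √s = (w + 1) / (2 * √w) := by rw [hs, sqrt_sq_div_four_mul w (by positivity)]
  have e2 : √(s - 1) = ι * (w - 1) / (2 * √w) := by
    rw [hs1, sqrt_sq_div_four_mul w hwι.le]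
  have hs0 : 0 ≤ s := by rw [hs]; positivity
  rw [K, Real.sqrt_mul hs0, e1, e2]
  rcases hι with rfl | rfl
  · have e3 : (w + 1) / (2 * √w) + 1 * (w - 1) / (2 * √w) = √w := by
      field_simp; rw [hsq]; ring
    rw [e3, Real.log_sqrt hw.le]
    field_simp
    rw [hsq]
    ring
  · have e3 : (w + 1) / (2 * √w) + -1 * (w - 1) / (2 * √w) = (√w)⁻¹ := by
      field_simp; ring
    rw [e3, Real.log_inv, Real.log_sqrt hw.le]
    field_simp
    rw [hsq]
    ring

lemma hasDerivAt_mul_K (hw : 0 < w) {s : ℝ} (hs : s = (w + 1) ^ 2 / (4 * w))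
    (hι : ι = 1 ∨ ι = -1) (hwι : 0 < ι * (w - 1)) :
    HasDerivAt (fun s => ι * K s) ((w - 1) / (w + 1)) s := by
  have hw1 : √w ≠ 0 := (Real.sqrt_pos.2 hw).ne'
  have hι2 : ι ^ 2 = 1 := by rcases hι with rfl | rfl <;> norm_num
  have hs1 : s - 1 = (ι * (w - 1)) ^ 2 / (4 * w) := by
    rw [hs, mul_pow, hι2]; field_simp; ring
  have hs' : 1 < s := by
    rw [← sub_pos, hs1]; positivity
  refine ((hasDerivAt_K hs').const_mul ι).congr_deriv ?_
  rw [hs1, hs, sqrt_sq_div_four_mul w hwι.le, sqrt_sq_div_four_mul w (by positivity)]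
  field_simp
  rw [hι2, one_mul]

lemma hasFDerivAt_norm_of_ne {x : E3} (hx : 0 < ‖x‖) :
    HasFDerivAt (fun y : E3 => ‖y‖) (‖x‖⁻¹ • innerSL ℝ x) x := by
  have h := (hasStrictFDerivAt_norm_sq x).hasFDerivAt.sqrt (by positivity)
  simp only [Real.sqrt_sq (norm_nonneg _)] at h
  refine h.congr_fderiv (ContinuousLinearMap.ext fun ξ => ?_)
  simp
  field_simp

/-- With ιK' = (w - 1)/(w + 1), the chain rule gives (w𝒜 - αx/|x|)/(w + 1), which is v by `snd_eq`.
-/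
lemma hasGradientAt_generating_left (hq : 0 < q) (hz : 0 < ‖z.1‖)
    (hι : ι = 1 ∨ ι = -1) (hwι : 0 < ι * (orbitParam q z - 1)) :
    HasGradientAt (fun y => generating q ι y (action q z)) z.2 z.1 := by
  have hα := speed_pos hq hz
  have hw := orbitParam_pos hq hz
  have hn := hasFDerivAt_norm_of_ne hz
  have hin := (hasFDerivAt_id (𝕜 := ℝ) z.1).inner ℝ (hasFDerivAt_const (action q z) z.1)
  have hρ := (hin.add (hn.mul_const ‖action q z‖)).const_mul (‖action q z‖ / (2 * q))
  have hK := (hasDerivAt_mul_K hw (rho_action hq hz) hι hwι).comp_hasFDerivAt z.1 hρ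
  have h := (hK.const_mul (q / ‖action q z‖)).sub
    (((hn.mul_const ‖action q z‖).sub hin).const_mul (1 / 2))
  rw [hasGradientAt_iff_hasFDerivAt]
  have e : (fun y => generating q ι y (action q z)) = fun y =>
      q / ‖action q z‖ * (ι * K (rho q y (action q z))) -
        1 / 2 * (‖y‖ * ‖action q z‖ - ⟪y, action q z⟫) := by
    funext y
    rw [generating]
    ring
  rw [e]
  refine HasFDerivAt.congr_fderiv h (ContinuousLinearMap.ext fun ξ => ?_)
  have hv : ⟪z.2, ξ⟫ = (orbitParam q z + 1)⁻¹ * (orbitParam q z * ⟪action q z, ξ⟫ -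
      speed q z / ‖z.1‖ * ⟪z.1, ξ⟫) := by
    conv_lhs => rw [snd_eq hq hz]
    simp only [inner_smul_left, inner_sub_left, RCLike.conj_to_real]
  simp [hv, norm_action hq hz, real_inner_comm (action q z) ξ]
  field_simp
  ring

/-- Because of the prefactor q/|a|, the value of ιK enters as well as its derivative; it supplies
the logarithm in `drift`. -/
lemma hasGradientAt_generating_right (hq : 0 < q) (hz : 0 < ‖z.1‖)
    (hι : ι = 1 ∨ ι = -1) (hwι : 0 < ι * (orbitParam q z - 1)) :
    HasGradientAt (fun b => generating q ι z.1 b) (angle q z) (action q z) := by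
  have hα := speed_pos hq hz
  have hw := orbitParam_pos hq hz
  have ha : 0 < ‖action q z‖ := by rwa [norm_action hq hz]
  have hn := hasFDerivAt_norm_of_ne ha
  have hin := (hasFDerivAt_const z.1 (action q z)).inner ℝ (hasFDerivAt_id (𝕜 := ℝ) (action q z))
  have hinv := ((hasDerivAt_inv ha.ne').comp_hasFDerivAt (action q z) hn).const_mul q
  have hρ := (hn.mul_const (1 / (2 * q))).mul (hin.add (hn.const_mul ‖z.1‖))
  have hs : ‖action q z‖ * (1 / (2 * q)) * (⟪z.1, action q z⟫ + ‖z.1‖ * ‖action q z‖) =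
      (orbitParam q z + 1) ^ 2 / (4 * orbitParam q z) := by
    rw [← rho_action hq hz, rho]
    ring
  have hK := (hasDerivAt_mul_K hw hs hι hwι).comp_hasFDerivAt (action q z) hρ
  have h := (hinv.mul hK).sub (((hn.const_mul ‖z.1‖).sub hin).const_mul (1 / 2))
  rw [hasGradientAt_iff_hasFDerivAt]
  have e : (fun b => generating q ι z.1 b) = fun b =>
      q * ‖b‖⁻¹ * (ι * K (‖b‖ * (1 / (2 * q)) * (⟪z.1, b⟫ + ‖z.1‖ * ‖b‖))) -
        1 / 2 * (‖z.1‖ * ‖b‖ - ⟪z.1, b⟫) := by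
    funext b
    rw [generating, rho, div_eq_mul_one_div ‖b‖]
    ring
  rw [e]
  refine HasFDerivAt.congr_fderiv h (ContinuousLinearMap.ext fun ξ => ?_)
  have hΘ : ⟪angle q z, ξ⟫ = orbitParam q z / (orbitParam q z + 1) * ⟪z.1, ξ⟫ +
      drift q z * ⟪action q z, ξ⟫ := by
    simp only [angle, inner_smul_left, inner_add_left, RCLike.conj_to_real]
  have hKv := mul_K_eq hw hs hι hwι
  simp [hΘ] at hKv ⊢
  rw [hKv, norm_action hq hz, inner_fst_action hq hz, drift]
  field_simp
  ring

lemma generatedAt_actionAngle (hq : 0 < q) (hz : 0 < ‖z.1‖)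
    (hι : ι = 1 ∨ ι = -1) (hwι : 0 < ι * (orbitParam q z - 1)) :
    GeneratedAt q ι (actionAngle q) z.1 z.2 := by
  have h1 := hasGradientAt_generating_left hq hz hι hwι
  have h2 := hasGradientAt_generating_right hq hz hι hwι
  rw [GeneratedAt, Prod.mk.eta, actionAngle]
  exact ⟨h1, h2⟩

lemma generatedAt_of_foldFunction_neg (hq : 0 < q) (hz : 0 < ‖z.1‖)
    (h : foldFunction q z.1 z.2 < 0) :
    GeneratedAt q (-1) (actionAngleEquiv q hq) z.1 z.2 := by
  rw [coe_actionAngleEquiv]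
  refine generatedAt_actionAngle hq hz (Or.inr rfl) ?_
  have := (foldFunction_neg_iff hq hz).1 h
  linarith

lemma generatedAt_of_foldFunction_pos (hq : 0 < q) (hz : 0 < ‖z.1‖)
    (h : 0 < foldFunction q z.1 z.2) :
    GeneratedAt q 1 (actionAngleEquiv q hq) z.1 z.2 := by
  rw [coe_actionAngleEquiv]
  refine generatedAt_actionAngle hq hz (Or.inl rfl) ?_
  have := (foldFunction_pos_iff hq hz).1 h
  linarith

end Kepler

end

theorem mainTheorem2 (q : ℝ) (hq : 0 < q) :
    ∃ T : PartialEquiv (Kepler.E3 × Kepler.E3) (Kepler.E3 × Kepler.E3),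
      -- `T` is a smooth diffeomorphism between the two phase spaces
      (T.source = Kepler.physicalPhaseSpace ∧
        T.target = Kepler.actionAnglePhaseSpace ∧
        ContDiffOn ℝ ∞ T T.source ∧
        ContDiffOn ℝ ∞ T.symm T.target) ∧
      -- it is canonical
      Kepler.IsCanonicalOn T Kepler.physicalPhaseSpace ∧
      -- it is compatible with conservation of energy and of angular momentum
      (∀ x v : Kepler.E3, 0 < ‖x‖ →
        Kepler.energy q x v = ‖(T (x, v)).2‖ ^ 2 ∧
        Kepler.cross x v = Kepler.cross (T (x, v)).1 (T (x, v)).2) ∧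
      -- it linearizes the flow
      (∀ I : Set ℝ, I.OrdConnected → (0 : ℝ) ∈ I →
        ∀ x v : ℝ → Kepler.E3, (∀ t ∈ I, 0 < ‖x t‖) →
          (Kepler.SolvesKeplerOn q I x v ↔
            ∀ t ∈ I, (T (x t, v t)).1 = (T (x 0, v 0)).1 + t • (T (x 0, v 0)).2 ∧
              (T (x t, v t)).2 = (T (x 0, v 0)).2)) ∧
      -- it has the asymptotic action property
      (∀ ϑ a : Kepler.E3, 0 < ‖a‖ →
        (fun t : ℝ => ‖(T.symm (ϑ + t • a, a)).1 - t • a‖) =o[atTop] (fun t : ℝ => t) ∧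
        (fun t : ℝ => ‖(T.symm (ϑ + t • a, a)).2 - a‖) =o[atTop] (fun _ : ℝ => (1 : ℝ))) ∧
      -- it is generated by `S_-` before the fold and by `S_+` after the fold
      (∀ x v : Kepler.E3, 0 < ‖x‖ →
        1 ≤ Kepler.rho q x (T (x, v)).2 ∧
        (Kepler.rho q x (T (x, v)).2 = 1 ↔ Kepler.foldFunction q x v = 0) ∧
        (Kepler.foldFunction q x v < 0 → Kepler.GeneratedAt q (-1) T x v) ∧
        (0 < Kepler.foldFunction q x v → Kepler.GeneratedAt q 1 T x v)) := by
  refine ⟨Kepler.actionAngleEquiv q hq, ⟨rfl, rfl, fun z hz => ?_, fun y hy => ?_⟩, ?_, ?_, ?_,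
    ?_, ?_⟩
  · exact (Kepler.contDiffAt_actionAngle hq hz).contDiffWithinAt
  · exact (Kepler.contDiffAt_symm hq hy).contDiffWithinAt
  · exact fun z hz ξ ζ => Kepler.canonicalForm_fderiv_actionAngle hq hz ξ ζ
  · intro x v hx
    have hz : 0 < ‖(x, v).1‖ := hx
    refine ⟨?_, (Kepler.cross_angle_action hq hz).symm⟩
    change _ = ‖Kepler.action q (x, v)‖ ^ 2
    rw [Kepler.norm_action_sq hq hz]
    exact (Real.sq_sqrt (Kepler.energy_pos hq hz).le).symm
  · exact fun I hI h0 x v hx =>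
      ⟨fun h t ht => Kepler.actionAngle_of_solvesKeplerOn hq hI h0 hx h ht,
        fun h => Kepler.solvesKeplerOn_of_actionAngle hq h0 hx h⟩
  · exact fun ϑ a ha => ⟨Kepler.isLittleO_fst_symm hq ϑ ha, Kepler.isLittleO_snd_symm hq ϑ ha⟩
  · intro x v hx
    have hz : 0 < ‖(x, v).1‖ := hx
    exact ⟨Kepler.one_le_rho_action (z := (x, v)) hq hz,
      Kepler.rho_action_eq_one_iff (z := (x, v)) hq hz,
      fun h => Kepler.generatedAt_of_foldFunction_neg (z := (x, v)) hq hz h,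
      fun h => Kepler.generatedAt_of_foldFunction_pos (z := (x, v)) hq hz h⟩
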